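/- **Generalised probabilistic theories.** A GPT consists of a symmetric monoidal category of systems $A,B,\dots$ (trivial system $I$) in which every hom-set $V_A^B$ (from $A$ to $B$) is a finite-dimensional real vector space and composition and tensor product are bilinear, together with closed convex cones $K_A^B\subseteq V_A^B$ of (physical) *processes* such that: * each $K_A^B$ spans $V_A^B$; processes are closed under sequential and parallel composition and contain the identities, the swaps and the coherence isomorphisms; * $V_I^I\cong\mathbb R$ with $\mathrm{id}_I\mapsto 1$ and $K_I^I\mapsto\mathbb R_{\ge 0}$ (numbers); * every system $A$ has a discarding effect $d_A$ in the interior of the effect cone $K_A:=K_A^I$, with $d_{A\otimes B}=d_A\otimes d_B$ and $d_I=1$; * (tomography) processes $f,g:A\to B$ are equal if $e\circ(f\otimes \mathrm{id}_D)\circ s=e\circ(g\otimes \mathrm{id}_D)\circ s$ for all systems $D$, all states $s\in K^{A\otimes D}:=K_I^{A\otimes D}$ and all effects $e\in K_{B\otimes D}$. Write $f\le g$ if $g-f$ is a process. A process $f:A\to B$ is *causal* if $d_B\circ f=d_A$ and *subcausal* if $d_B\circ f\le d_A$. **Money.** A *bank strategy* on a system $A$ is a finite family $\mathcal S_A=\{(p_i,s_i,e_i)\}_i$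 with $p_i>0$, $\sum_i p_i=1$, causal states $s_i$ of $A$, and effects $e_i\in K_A$ with $e_i\le d_A$ and $e_i\circ s_i=1$. It is *spanning* if the $s_i$ span $V^A:=V_I^A$. Its counterfeiting success is $$\alpha(\mathcal S_A)=\sup\Big\{\sum_i p_i\,(e_i\otimes e_i)\circ\chi\circ s_i\;:\;\chi\in K_A^{A\otimes A}\text{ subcausal}\Big\}.$$ The product of two strategies $\{(p_i,s_i,e_i)\}_i$ on $A$ and $\{(q_j,t_j,f_j)\}_j$ on $B$ is the strategy $\{(p_iq_j,\,s_i\otimes t_j,\,e_i\otimes f_j)\}_{i,j}$ on $A\otimes B$; $\mathcal S^{\otimes n}$ denotes the $n$-fold independent repetition of $\mathcal S$ obtained in this way. Call $\mathcal S$ *exponentially secure* if there is $r\in(0,1)$ with $\alpha(\mathcal S^{\otimes n})\le r^n$ for all $n\ge 0$. The theory satisfies **WNC** if some bank strategy has $\alpha<1$, and **SNC** if for every $\delta>0$ some bank strategy has $\alpha\le\delta$. **Theorem.** In every GPT: 1. WNC holds if and only if SNC holds. 2. If some bank strategy on a system $A$ has $\alpha<1$, then there is a spanning bank strategy $\mathcal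 S$ on $A$ with $\alpha(\mathcal S)<1$ that is exponentially secure; in particular, for every $\delta>0$ there is $n\ge1$ with $\alpha(\mathcal S^{\otimes n})\le\delta$. 3. Exactly one of the following holds: (a) perfect counterfeiting: every bank strategy has $\alpha=1$, attained by some subcausal $\chi$; (b) there is an exponentially secure spanning bank strategy. -/

import Mathlib

open CategoryTheory MonoidalCategory

universe v u

/-- A generalised probabilistic theory. The objects of `C` are the systems, `⊗` is parallel
composition, and the hom-space `A ⟶ B` is the real vector space `V_A^B`. The physical processes
from `A` to `B` are the elements of `cone A B`, which is the cone `K_A^B`. States of `A` are the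
processes `𝟙_ C ⟶ A`, effects on `A` are the processes `A ⟶ 𝟙_ C`, and numbers are the processes
`𝟙_ C ⟶ 𝟙_ C`. The finite-dimensional spaces `A ⟶ B` carry their canonical (module) topology. -/
structure GPT (C : Type u) [Category.{v} C] [MonoidalCategory C] [SymmetricCategory C]
    [Preadditive C] [Linear ℝ C] [MonoidalPreadditive C] [MonoidalLinear ℝ C] where
  /-- The convex cone of processes from `A` to `B`. -/
  cone : ∀ A B : C, PointedCone ℝ (A ⟶ B)
  finiteDimensional : ∀ A B : C, FiniteDimensional ℝ (A ⟶ B)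
  span_cone : ∀ A B : C, Submodule.span ℝ (cone A B : Set (A ⟶ B)) = ⊤
  isClosed_cone : ∀ A B : C, @IsClosed (A ⟶ B) (moduleTopology ℝ (A ⟶ B)) (cone A B)
  /- Processes are closed under being wired together. -/
  id_mem : ∀ A : C, 𝟙 A ∈ cone A A
  comp_mem : ∀ {X Y Z : C} {f : X ⟶ Y} {g : Y ⟶ Z},
    f ∈ cone X Y → g ∈ cone Y Z → f ≫ g ∈ cone X Z
  tensor_mem : ∀ {X Y Z W : C} {f : X ⟶ Y} {g : Z ⟶ W},
    f ∈ cone X Y → g ∈ cone Z W → (f ⊗ₘ g) ∈ cone (X ⊗ Z) (Y ⊗ W)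
  associator_hom_mem : ∀ X Y Z : C, (α_ X Y Z).hom ∈ cone ((X ⊗ Y) ⊗ Z) (X ⊗ (Y ⊗ Z))
  associator_inv_mem : ∀ X Y Z : C, (α_ X Y Z).inv ∈ cone (X ⊗ (Y ⊗ Z)) ((X ⊗ Y) ⊗ Z)
  leftUnitor_hom_mem : ∀ X : C, (λ_ X).hom ∈ cone (𝟙_ C ⊗ X) X
  leftUnitor_inv_mem : ∀ X : C, (λ_ X).inv ∈ cone X (𝟙_ C ⊗ X)
  rightUnitor_hom_mem : ∀ X : C, (ρ_ X).hom ∈ cone (X ⊗ 𝟙_ C) X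
  rightUnitor_inv_mem : ∀ X : C, (ρ_ X).inv ∈ cone X (X ⊗ 𝟙_ C)
  braiding_mem : ∀ X Y : C, (β_ X Y).hom ∈ cone (X ⊗ Y) (Y ⊗ X)
  /-- The numbers of the theory are the non-negative reals. -/
  num : (𝟙_ C ⟶ 𝟙_ C) ≃ₗ[ℝ] ℝ
  num_id : num (𝟙 (𝟙_ C)) = 1
  mem_cone_num : ∀ r : 𝟙_ C ⟶ 𝟙_ C, r ∈ cone (𝟙_ C) (𝟙_ C) ↔ 0 ≤ num r
  /-- The discarding effects. -/
  disc : ∀ A : C, A ⟶ 𝟙_ C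
  disc_mem_interior : ∀ A : C,
    disc A ∈ @interior (A ⟶ 𝟙_ C) (moduleTopology ℝ (A ⟶ 𝟙_ C)) (cone A (𝟙_ C))
  disc_tensor : ∀ A B : C, disc (A ⊗ B) = (disc A ⊗ₘ disc B) ≫ (λ_ (𝟙_ C)).hom
  disc_unit : disc (𝟙_ C) = 𝟙 (𝟙_ C)
  /-- Tomography: processes that give the same numbers in all situations are equal. -/
  tomography : ∀ {A B : C} {f g : A ⟶ B}, f ∈ cone A B → g ∈ cone A B →
    (∀ (D : C) (s : 𝟙_ C ⟶ A ⊗ D) (e : B ⊗ D ⟶ 𝟙_ C),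
      s ∈ cone (𝟙_ C) (A ⊗ D) → e ∈ cone (B ⊗ D) (𝟙_ C) →
        s ≫ (f ▷ D) ≫ e = s ≫ (g ▷ D) ≫ e) → f = g

namespace GPT

variable {C : Type u} [Category.{v} C] [MonoidalCategory C] [SymmetricCategory C]
  [Preadditive C] [Linear ℝ C] [MonoidalPreadditive C] [MonoidalLinear ℝ C]

/-- The order on processes: `f ≤ g` if `g = f + z` for a physical process `z`. -/
def ProcLE (T : GPT C) {A B : C} (f g : A ⟶ B) : Prop := g - f ∈ T.cone A B

/-- A process is causal if discarding its output amounts to discarding its input. -/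
def Causal (T : GPT C) {A B : C} (f : A ⟶ B) : Prop :=
  f ∈ T.cone A B ∧ f ≫ T.disc B = T.disc A

/-- A process is subcausal if discarding its output is below discarding its input. -/
def Subcausal (T : GPT C) {A B : C} (f : A ⟶ B) : Prop :=
  f ∈ T.cone A B ∧ T.ProcLE (f ≫ T.disc B) (T.disc A)

/-- The parallel composite of two vectors of the state spaces of `A` and `B`. -/
def tensorState {A B : C} (s : 𝟙_ C ⟶ A) (t : 𝟙_ C ⟶ B) : 𝟙_ C ⟶ A ⊗ B :=
  (λ_ (𝟙_ C)).inv ≫ (s ⊗ₘ t)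

/-- The parallel composite of two vectors of the effect spaces of `A` and `B`. -/
def tensorEffect {A B : C} (e : A ⟶ 𝟙_ C) (f : B ⟶ 𝟙_ C) : A ⊗ B ⟶ 𝟙_ C :=
  (e ⊗ₘ f) ≫ (λ_ (𝟙_ C)).hom

/-- A bank strategy on the system `A`: a finite ensemble `(p i, s i)` of causal states with
positive probabilities, and for each of them a subcausal effect `e i` that always accepts `s i`. -/
structure BankStrategy (T : GPT C) (A : C) where
  ι : Type
  fintype : Fintype ι
  p : ι → ℝ
  p_pos : ∀ i, 0 < p i
  p_sum : ∑ i, p i = 1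
  s : ι → (𝟙_ C ⟶ A)
  s_causal : ∀ i, T.Causal (s i)
  e : ι → (A ⟶ 𝟙_ C)
  e_mem : ∀ i, e i ∈ T.cone A (𝟙_ C)
  e_le : ∀ i, T.ProcLE (e i) (T.disc A)
  accepts : ∀ i, T.num (s i ≫ e i) = 1

attribute [instance] BankStrategy.fintype

/-- The physical counterfeiting machines on `A`. -/
def machines (T : GPT C) (A : C) : Set (A ⟶ A ⊗ A) := {χ | T.Subcausal χ}

/-- The probability that both outputs of `χ` pass the bank's independent verifications. -/
def success (T : GPT C) {A : C} (S : BankStrategy T A) (χ : A ⟶ A ⊗ A) : ℝ :=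
  ∑ i, S.p i * T.num (S.s i ≫ χ ≫ tensorEffect (S.e i) (S.e i))

/-- The optimal success probability of a counterfeiter against `S`. -/
noncomputable def alpha (T : GPT C) {A : C} (S : BankStrategy T A) : ℝ :=
  sSup (T.success S '' T.machines A)

/-- A bank strategy is spanning if its states span the state space of its system. -/
def Spanning (T : GPT C) {A : C} (S : BankStrategy T A) : Prop :=
  Submodule.span ℝ (Set.range S.s) = ⊤

/-- Weak no-counterfeiting. -/
def WNC (T : GPT C) : Prop := ∃ (A : C) (S : BankStrategy T A), T.alpha S < 1

/-- Strong no-counterfeiting. -/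
def SNC (T : GPT C) : Prop :=
  ∀ δ : ℝ, 0 < δ → ∃ (A : C) (S : BankStrategy T A), T.alpha S ≤ δ

/-- Every bank strategy can be counterfeited perfectly. -/
def PerfectCounterfeiting (T : GPT C) : Prop :=
  ∀ (A : C) (S : BankStrategy T A),
    T.alpha S = 1 ∧ ∃ χ ∈ T.machines A, T.success S χ = 1

theorem disc_mem (T : GPT C) (A : C) : T.disc A ∈ T.cone A (𝟙_ C) :=
  @interior_subset (A ⟶ 𝟙_ C) (moduleTopology ℝ (A ⟶ 𝟙_ C)) _ _ (T.disc_mem_interior A)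

theorem tensorState_comp_tensorEffect {A B : C} (s : 𝟙_ C ⟶ A) (t : 𝟙_ C ⟶ B)
    (e : A ⟶ 𝟙_ C) (f : B ⟶ 𝟙_ C) :
    tensorState s t ≫ tensorEffect e f = (s ≫ e) ≫ (t ≫ f) := by
  simp only [tensorState, tensorEffect, Category.assoc]
  rw [← Category.assoc (s ⊗ₘ t), tensorHom_comp_tensorHom, MonoidalCategory.tensorHom_def,
    unitors_equal]
  simp [← unitors_inv_equal, ← unitors_equal]

theorem num_comp (T : GPT C) (r q : 𝟙_ C ⟶ 𝟙_ C) : T.num (r ≫ q) = T.num r * T.num q := by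
  have h : r = T.num r • 𝟙 (𝟙_ C) := T.num.injective (by simp [T.num_id])
  conv_lhs => rw [h]
  simp

/-- The product strategy: one state is sampled from each of the strategies independently. -/
def BankStrategy.prod {T : GPT C} {A B : C} (S : BankStrategy T A) (S' : BankStrategy T B) :
    BankStrategy T (A ⊗ B) where
  ι := S.ι × S'.ι
  fintype := inferInstance
  p k := S.p k.1 * S'.p k.2
  p_pos k := mul_pos (S.p_pos _) (S'.p_pos _)
  p_sum := by
    rw [Fintype.sum_prod_type]
    simp only [← Finset.mul_sum, S'.p_sum, mul_one, S.p_sum]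
  s k := tensorState (S.s k.1) (S'.s k.2)
  s_causal k := by
    refine ⟨T.comp_mem (T.leftUnitor_inv_mem _)
      (T.tensor_mem (S.s_causal _).1 (S'.s_causal _).1), ?_⟩
    have h := tensorState_comp_tensorEffect (S.s k.1) (S'.s k.2) (T.disc A) (T.disc B)
    rw [T.disc_tensor]
    rw [tensorEffect] at h
    rw [h, (S.s_causal _).2, (S'.s_causal _).2, T.disc_unit, Category.comp_id]
  e k := tensorEffect (S.e k.1) (S'.e k.2)
  e_mem k := T.comp_mem (T.tensor_mem (S.e_mem _) (S'.e_mem _)) (T.leftUnitor_hom_mem _)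
  e_le k := by
    have h : T.disc (A ⊗ B) - tensorEffect (S.e k.1) (S'.e k.2) =
        tensorEffect (T.disc A - S.e k.1) (T.disc B)
          + tensorEffect (S.e k.1) (T.disc B - S'.e k.2) := by
      rw [sub_eq_iff_eq_add, T.disc_tensor]
      simp only [tensorEffect, ← Preadditive.add_comp]
      rw [add_assoc, ← MonoidalPreadditive.tensor_add, sub_add_cancel,
        ← MonoidalPreadditive.add_tensor, sub_add_cancel]
    rw [ProcLE, h]
    exact Submodule.add_mem _
      (T.comp_mem (T.tensor_mem (S.e_le _) (T.disc_mem _)) (T.leftUnitor_hom_mem _))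
      (T.comp_mem (T.tensor_mem (S.e_mem _) (S'.e_le _)) (T.leftUnitor_hom_mem _))
  accepts k := by
    rw [tensorState_comp_tensorEffect, T.num_comp, S.accepts, S'.accepts, mul_one]

/-- The strategy on the trivial system with a single state and a single effect, both the
number `1`. -/
def BankStrategy.unit (T : GPT C) : BankStrategy T (𝟙_ C) where
  ι := Unit
  fintype := inferInstance
  p _ := 1
  p_pos _ := one_pos
  p_sum := by simp
  s _ := 𝟙 (𝟙_ C)
  s_causal _ := ⟨T.id_mem _, by simp⟩
  e _ := 𝟙 (𝟙_ C)
  e_mem _ := T.id_mem _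
  e_le _ := by simp [ProcLE, T.disc_unit]
  accepts _ := by simp [T.num_id]

/-- The `n`-fold composite `A ⊗ (A ⊗ ⋯ )` of a system. -/
def systemPow (A : C) : ℕ → C
  | 0 => 𝟙_ C
  | n + 1 => A ⊗ systemPow A n

/-- The `n`-fold independent repetition of a bank strategy. -/
def BankStrategy.rep {T : GPT C} {A : C} (S : BankStrategy T A) :
    (n : ℕ) → BankStrategy T (systemPow A n)
  | 0 => BankStrategy.unit T
  | n + 1 => S.prod (S.rep n)

/-- The optimal counterfeiting probability against the `n`-fold independent repetition of `S`
decays exponentially in `n`. -/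
def ExponentiallySecure (T : GPT C) {A : C} (S : BankStrategy T A) : Prop :=
  ∃ r : ℝ, 0 < r ∧ r < 1 ∧ ∀ n : ℕ, T.alpha (S.rep n) ≤ r ^ n

end GPT

/-!
The optimal value `α` is that of a conic program: maximise the success probability over processes
`χ` with `χ ≫ d ≤ d`. Since `d` is an order unit, strong duality produces a functional `φ` on
effects with `φ d = α` and `success χ ≤ φ (χ ≫ d)`, and by tomography `φ` is the pairing with some
vector `v` of the state space, not necessarily physical. The average state `σ` of the strategy also
satisfies `success χ ≤ σ ≫ χ ≫ d`, and for a spanning strategy it is an order unit of the state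
cone; hence, if `α < 1`, a convex combination of `σ` and `v` with enough weight on `σ` is a
physical state `τ` with the same domination property and with `τ ≫ d < 1`.

Such a `τ` makes `α` decay under repetition. From a machine for `A ⊗ B`, feeding `τ` into `A` and
discarding the two copies of `A` gives a machine for `B` that succeeds at least as often and whose
output is bounded by `τ ≫ d`, so every further independent copy of the strategy multiplies `α` by at
most `τ ≫ d`. A strategy is made spanning by mixing it with causal states that are always accepted.
-/

section OrderUnit

open scoped Topology

variable {R E ι : Type*} [Field R] [LinearOrder R] [IsStrictOrderedRing R]
  [AddCommGroup E] [Module R E]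

/-- An order unit of a cone: every vector enters the cone after adding a positive multiple of `u`.
Such a `u` belongs to the cone, as the case `v = 0` shows. -/
def IsOrderUnit (K : PointedCone R E) (u : E) : Prop :=
  ∀ v, ∃ c : R, 0 < c ∧ c • u + v ∈ K

theorem IsOrderUnit.mem {K : PointedCone R E} {u : E} (hu : IsOrderUnit K u) : u ∈ K := by
  obtain ⟨c, hc, h⟩ := hu 0
  rw [add_zero] at h
  simpa [smul_smul, hc.ne'] using K.smul_mem (inv_nonneg.2 hc.le) h

theorem IsOrderUnit.eq_zero_of_apply_eq_zero {K : PointedCone R E} {u : E} (hu : IsOrderUnit K u)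
    {f : E →ₗ[R] R} (hf : ∀ x ∈ K, 0 ≤ f x) (h : f u = 0) : f = 0 := by
  have nonneg (v : E) : 0 ≤ f v := by
    obtain ⟨c, -, hc⟩ := hu v
    simpa [h] using hf _ hc
  exact LinearMap.ext fun v =>
    (neg_nonneg.1 ((nonneg (-v)).trans_eq (map_neg f v))).antisymm (nonneg v)

theorem isOrderUnit_sum_smul [Fintype ι] {K : PointedCone R E} {x : ι → E} {p : ι → R}
    (hx : ∀ i, x i ∈ K) (hp : ∀ i, 0 < p i) (hspan : Submodule.span R (Set.range x) = ⊤) :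
    IsOrderUnit K (∑ i, p i • x i) := by
  intro v
  obtain ⟨a, rfl⟩ := (Submodule.mem_span_range_iff_exists_fun R).1
    (hspan ▸ Submodule.mem_top : v ∈ Submodule.span R (Set.range x))
  have ratio_nonneg (i : ι) : 0 ≤ |a i| / p i := div_nonneg (abs_nonneg _) (hp i).le
  set c := 1 + ∑ i, |a i| / p i
  have ratio_le (i : ι) : |a i| / p i ≤ c :=
    (Finset.single_le_sum (fun j _ => ratio_nonneg j) (Finset.mem_univ i)).trans
      (le_add_of_nonneg_left zero_le_one)
  have coeff_nonneg (i : ι) : 0 ≤ c * p i + a i := by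
    have := (div_le_iff₀ (hp i)).1 (ratio_le i)
    linarith [neg_abs_le (a i)]
  refine ⟨c, add_pos_of_pos_of_nonneg one_pos (Finset.sum_nonneg fun i _ => ratio_nonneg i), ?_⟩
  simp only [Finset.smul_sum, ← Finset.sum_add_distrib, smul_smul, ← add_smul]
  exact Submodule.sum_mem _ fun i _ => K.smul_mem (coeff_nonneg i) (hx i)

theorem exists_isOrderUnit_of_span_eq_top [FiniteDimensional R E] {K : PointedCone R E}
    (hK : Submodule.span R (K : Set E) = ⊤) : ∃ u, IsOrderUnit K u := by
  obtain ⟨x, hx, hspan, -⟩ := Submodule.exists_fun_fin_finrank_span_eq R (K : Set E)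
  exact ⟨_, isOrderUnit_sum_smul hx (fun _ => one_pos) (hspan.trans hK)⟩

theorem isOrderUnit_of_mem_interior {E : Type*} [AddCommGroup E] [Module ℝ E]
    [TopologicalSpace E] [ContinuousAdd E] [ContinuousSMul ℝ E] {K : PointedCone ℝ E} {u : E}
    (hu : u ∈ interior (K : Set E)) : IsOrderUnit K u := by
  intro v
  have hcont : Continuous fun t : ℝ => u + t • v := by fun_prop
  have hnear : ∀ᶠ t : ℝ in 𝓝[>] 0, u + t • v ∈ K :=
    nhdsWithin_le_nhds <| hcont.continuousAt (x := 0)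
      (by simpa using mem_interior_iff_mem_nhds.1 hu)
  obtain ⟨t, ht, hpos⟩ := (hnear.and self_mem_nhdsWithin).exists
  have htpos : 0 < t := hpos
  refine ⟨t⁻¹, inv_pos.2 htpos, ?_⟩
  simpa [smul_smul, htpos.ne'] using K.smul_mem (inv_nonneg.2 htpos.le) ht

end OrderUnit

section ConicDuality

variable {E F : Type*} [AddCommGroup E] [Module ℝ E] [AddCommGroup F] [Module ℝ F]

/-- Strong duality for the conic program `sup {w x | x ∈ K, d - L x ∈ P}`, by the M. Riesz extension
of `(0, b) ↦ b` along the cone in `F × ℝ` generated by the vectors `(L x, -w x)`, `(y, 0)` and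
`±(-d, β)`. -/
theorem exists_dual_functional {K : PointedCone ℝ E} {P : PointedCone ℝ F} {d : F}
    (hd : IsOrderUnit P d) (L : E →ₗ[ℝ] F) (w : E →ₗ[ℝ] ℝ) {β : ℝ}
    (hβ : ∀ x ∈ K, ∀ t : ℝ, t • d - L x ∈ P → w x ≤ t * β) :
    ∃ φ : F →ₗ[ℝ] ℝ, φ d = β ∧ (∀ y ∈ P, 0 ≤ φ y) ∧ ∀ x ∈ K, w x ≤ φ (L x) := by
  let Λ : E × F × ℝ →ₗ[ℝ] F × ℝ :=
    (L.coprod (LinearMap.id.coprod (LinearMap.toSpanSingleton ℝ F (-d)))).prod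
      ((-w).coprod (LinearMap.coprod 0 (LinearMap.toSpanSingleton ℝ ℝ β)))
  have Λ_apply (x : E) (y : F) (t : ℝ) : Λ (x, y, t) = (L x + (y - t • d), -w x + t * β) := by
    simp [Λ, sub_eq_add_neg]
  let Q : PointedCone ℝ (F × ℝ) := PointedCone.map Λ (Submodule.prod K (Submodule.prod P ⊤))
  have mem_Q {x : E} (hx : x ∈ K) {y : F} (hy : y ∈ P) (t : ℝ) :
      (L x + (y - t • d), -w x + t * β) ∈ Q :=
    PointedCone.mem_map.2 ⟨(x, y, t), ⟨hx, hy, trivial⟩, Λ_apply x y t⟩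
  obtain ⟨g, hg, hgQ⟩ := riesz_extension Q
    ⟨LinearMap.range (LinearMap.inr ℝ F ℝ), (LinearMap.snd ℝ F ℝ).domRestrict _⟩
    (by
      rintro ⟨_, b, rfl⟩ hQ
      obtain ⟨⟨x, y, t⟩, ⟨hx, hy, -⟩, h⟩ := PointedCone.mem_map.1 hQ
      obtain ⟨hfst, rfl⟩ := Prod.ext_iff.1 ((Λ_apply x y t).symm.trans h)
      change L x + (y - t • d) = 0 at hfst
      have hyx : t • d - L x = y := by
        rw [eq_neg_of_add_eq_zero_left hfst]
        abel
      change 0 ≤ -w x + t * β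
      linarith [hβ x hx t (hyx ▸ hy)])
    (by
      rintro ⟨e, b⟩
      obtain ⟨c, -, hc⟩ := hd e
      refine ⟨⟨_, c * β - b, rfl⟩, ?_⟩
      simpa using mem_Q (zero_mem K) hc c)
  have hg_inr (b : ℝ) : g (0, b) = b := hg ⟨(0, b), b, rfl⟩
  have hg_apply (y : F) (b : ℝ) : g (y, b) = g (y, 0) + b := by
    rw [← hg_inr b, ← map_add, Prod.mk_add_mk, add_zero, zero_add, hg_inr]
  refine ⟨g ∘ₗ LinearMap.inl ℝ F ℝ, ?_, fun y hy => ?_, fun x hx => ?_⟩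
  · have hline (t : ℝ) : 0 ≤ t * (β - g (d, 0)) := by
      have h := hgQ _ (mem_Q (zero_mem K) (zero_mem P) t)
      have hfst : (L 0 + (0 - t • d), (0 : ℝ)) = (-t) • (d, 0) := by simp
      rw [hg_apply, hfst, map_smul, smul_eq_mul, map_zero] at h
      linarith
    change g (d, 0) = β
    linarith [hline 1, hline (-1)]
  · simpa using hgQ _ (mem_Q (zero_mem K) hy 0)
  · have := hgQ _ (mem_Q hx (zero_mem P) 0)
    rw [hg_apply] at this
    simpa [neg_add_eq_sub] using this

end ConicDuality

section Compactness

variable {E : Type*} [AddCommGroup E] [Module ℝ E] [FiniteDimensional ℝ E] [TopologicalSpace E]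

theorem t2Space_of_isModuleTopology [IsModuleTopology ℝ E] : T2Space E :=
  .of_injective_continuous (Module.finBasis ℝ E).equivFun.injective
    (IsModuleTopology.continuous_of_linearMap (Module.finBasis ℝ E).equivFun.toLinearMap)

theorem isCompact_setOf_mem_cone_and_le [IsTopologicalAddGroup E] [ContinuousSMul ℝ E] [T2Space E]
    {K : PointedCone ℝ E} (hK : IsClosed (K : Set E)) {l : E →ₗ[ℝ] ℝ}
    (hl : ∀ x ∈ K, x ≠ 0 → 0 < l x) (c : ℝ) : IsCompact {x | x ∈ K ∧ l x ≤ c} := by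
  have hl_cont : Continuous l := l.continuous_of_finiteDimensional
  have sphere_compact : IsCompact {x | x ∈ K ∧ ‖toEuclidean x‖ = 1} :=
    (Euclidean.isCompact_closedBall (x := (0 : E)) (r := 1)).of_isClosed_subset
      (hK.inter (isClosed_eq (by fun_prop) continuous_const))
      fun x hx => by simpa [Euclidean.closedBall, Euclidean.dist] using hx.2.le
  obtain ⟨m, hm, hml⟩ := sphere_compact.exists_forall_le' hl_cont.continuousOn (a := 0) <| by
    rintro x ⟨hx, hx1⟩
    exact hl x hx (by rintro rfl; simp at hx1)
  have norm_le {x : E} (hx : x ∈ K) : m * ‖toEuclidean x‖ ≤ l x := by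
    rcases eq_or_ne x 0 with rfl | h0
    · simp
    have hpos : 0 < ‖toEuclidean x‖ := by simpa using h0
    have := hml (‖toEuclidean x‖⁻¹ • x)
      ⟨K.smul_mem (inv_nonneg.2 hpos.le) hx, by simp [norm_smul, hpos.ne']⟩
    rwa [map_smul, smul_eq_mul, le_inv_mul_iff₀ hpos, mul_comm] at this
  refine (Euclidean.isCompact_closedBall (x := (0 : E)) (r := c / m)).of_isClosed_subset
    (hK.inter (isClosed_le hl_cont continuous_const)) fun x ⟨hx, hxc⟩ => ?_
  simpa [Euclidean.closedBall, Euclidean.dist, le_div_iff₀' hm] using (norm_le hx).trans hxc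

end Compactness

namespace GPT

section Wiring

variable {C : Type u} [Category.{v} C] [MonoidalCategory C]

/-- Prepare the state `t` on the second factor. -/
def prepRight (A : C) {B : C} (t : 𝟙_ C ⟶ B) : A ⟶ A ⊗ B := (ρ_ A).inv ≫ A ◁ t

/-- Prepare the state `s` on the first factor. -/
def prepLeft {A : C} (s : 𝟙_ C ⟶ A) (B : C) : B ⟶ A ⊗ B := (λ_ B).inv ≫ s ▷ B

/-- Apply the effect `f` to the second factor. -/
def testRight (A : C) {B : C} (f : B ⟶ 𝟙_ C) : A ⊗ B ⟶ A := A ◁ f ≫ (ρ_ A).hom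

/-- Apply the effect `e` to the first factor. -/
def testLeft {A : C} (e : A ⟶ 𝟙_ C) (B : C) : A ⊗ B ⟶ B := e ▷ B ≫ (λ_ B).hom

theorem comp_prepRight {A B : C} (s : 𝟙_ C ⟶ A) (t : 𝟙_ C ⟶ B) :
    s ≫ prepRight A t = tensorState s t := by
  simp only [prepRight, tensorState, MonoidalCategory.tensorHom_def, unitors_inv_equal,
    rightUnitor_inv_naturality_assoc]

theorem comp_prepLeft {A B : C} (s : 𝟙_ C ⟶ A) (t : 𝟙_ C ⟶ B) :
    t ≫ prepLeft s B = tensorState s t := by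
  simp only [prepLeft, tensorState, tensorHom_def', leftUnitor_inv_naturality_assoc]

theorem testRight_comp {A B : C} (e : A ⟶ 𝟙_ C) (f : B ⟶ 𝟙_ C) :
    testRight A f ≫ e = tensorEffect e f := by
  simp only [testRight, tensorEffect, tensorHom_def', unitors_equal, Category.assoc,
    rightUnitor_naturality]

theorem testLeft_comp {A B : C} (e : A ⟶ 𝟙_ C) (f : B ⟶ 𝟙_ C) :
    testLeft e B ≫ f = tensorEffect e f := by
  simp only [testLeft, tensorEffect, MonoidalCategory.tensorHom_def, Category.assoc,
    leftUnitor_naturality]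

theorem prepLeft_comp_tensorEffect {A B : C} (s : 𝟙_ C ⟶ A) (e : A ⟶ 𝟙_ C) (f : B ⟶ 𝟙_ C) :
    prepLeft s B ≫ tensorEffect e f = (λ_ B).inv ≫ (s ≫ e) ▷ B ≫ (λ_ B).hom ≫ f := by
  simp [prepLeft, tensorEffect, MonoidalCategory.tensorHom_def]

theorem whiskerRight_comp_effect {A D : C} (e : A ⟶ 𝟙_ C) (h : 𝟙_ C ⊗ D ⟶ 𝟙_ C) :
    e ▷ D ≫ h = testRight A ((λ_ D).inv ≫ h) ≫ e := by
  rw [testRight_comp, tensorEffect, MonoidalCategory.tensorHom_def, whiskerLeft_comp]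
  simp

variable [BraidedCategory C]

theorem tensorμ_comp_tensorEffect {X₁ X₂ Y₁ Y₂ : C} (e₁ : X₁ ⟶ 𝟙_ C) (e₂ : X₂ ⟶ 𝟙_ C)
    (f₁ : Y₁ ⟶ 𝟙_ C) (f₂ : Y₂ ⟶ 𝟙_ C) :
    tensorμ X₁ X₂ Y₁ Y₂ ≫ tensorEffect (tensorEffect e₁ f₁) (tensorEffect e₂ f₂) =
      tensorEffect (tensorEffect e₁ e₂) (tensorEffect f₁ f₂) := by
  have tensorμ_unit :
      tensorμ (𝟙_ C) (𝟙_ C) (𝟙_ C) (𝟙_ C) ≫ ((λ_ (𝟙_ C)).hom ⊗ₘ (λ_ (𝟙_ C)).hom) =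
        ((λ_ (𝟙_ C)).hom ⊗ₘ (λ_ (𝟙_ C)).hom) := by
    conv_rhs => rw [leftUnitor_monoidal]
    congr 1
    monoidal
  simp only [tensorEffect, ← tensorHom_comp_tensorHom, Category.assoc]
  rw [← tensorμ_natural_assoc, reassoc_of% tensorμ_unit]

/-- The machine on the first factor obtained from a machine on `A ⊗ B` by preparing `t` on `B` and
applying the effect `f` to the two output copies of `B`. -/
def restrictLeft {A B : C} (t : 𝟙_ C ⟶ B) (f : B ⊗ B ⟶ 𝟙_ C)
    (χ : A ⊗ B ⟶ (A ⊗ B) ⊗ (A ⊗ B)) : A ⟶ A ⊗ A :=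
  prepRight A t ≫ χ ≫ tensorμ A B A B ≫ testRight (A ⊗ A) f

/-- The machine on the second factor obtained from a machine on `A ⊗ B` by preparing `s` on `A` and
applying the effect `e` to the two output copies of `A`. -/
def restrictRight {A B : C} (s : 𝟙_ C ⟶ A) (e : A ⊗ A ⟶ 𝟙_ C)
    (χ : A ⊗ B ⟶ (A ⊗ B) ⊗ (A ⊗ B)) : B ⟶ B ⊗ B :=
  prepLeft s B ≫ χ ≫ tensorμ A B A B ≫ testLeft e (B ⊗ B)

theorem comp_restrictLeft_comp {A B : C} (s : 𝟙_ C ⟶ A) (e : A ⊗ A ⟶ 𝟙_ C) (t : 𝟙_ C ⟶ B)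
    (f : B ⊗ B ⟶ 𝟙_ C) (χ : A ⊗ B ⟶ (A ⊗ B) ⊗ (A ⊗ B)) :
    s ≫ restrictLeft t f χ ≫ e = tensorState s t ≫ χ ≫ tensorμ A B A B ≫ tensorEffect e f := by
  simp only [restrictLeft, ← comp_prepRight, ← testRight_comp, Category.assoc]

theorem comp_restrictRight_comp {A B : C} (s : 𝟙_ C ⟶ A) (e : A ⊗ A ⟶ 𝟙_ C) (t : 𝟙_ C ⟶ B)
    (f : B ⊗ B ⟶ 𝟙_ C) (χ : A ⊗ B ⟶ (A ⊗ B) ⊗ (A ⊗ B)) :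
    t ≫ restrictRight s e χ ≫ f = tensorState s t ≫ χ ≫ tensorμ A B A B ≫ tensorEffect e f := by
  simp only [restrictRight, ← comp_prepLeft, ← testLeft_comp, Category.assoc]

end Wiring

variable {C : Type u} [Category.{v} C] [MonoidalCategory C] [SymmetricCategory C]
  [Preadditive C] [Linear ℝ C] [MonoidalPreadditive C] [MonoidalLinear ℝ C] {T : GPT C}

section Processes

theorem whiskerRight_mem {A B : C} {f : A ⟶ B} (hf : f ∈ T.cone A B) (D : C) :
    f ▷ D ∈ T.cone (A ⊗ D) (B ⊗ D) :=
  tensorHom_id f D ▸ T.tensor_mem hf (T.id_mem D)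

theorem whiskerLeft_mem {A B : C} {f : A ⟶ B} (hf : f ∈ T.cone A B) (D : C) :
    D ◁ f ∈ T.cone (D ⊗ A) (D ⊗ B) :=
  id_tensorHom D f ▸ T.tensor_mem (T.id_mem D) hf

theorem tensorEffect_mem {A B : C} {e : A ⟶ 𝟙_ C} {f : B ⟶ 𝟙_ C} (he : e ∈ T.cone A _)
    (hf : f ∈ T.cone B _) : tensorEffect e f ∈ T.cone (A ⊗ B) (𝟙_ C) :=
  T.comp_mem (T.tensor_mem he hf) (T.leftUnitor_hom_mem _)

theorem prepRight_mem (A : C) {B : C} {t : 𝟙_ C ⟶ B} (ht : t ∈ T.cone _ B) :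
    prepRight A t ∈ T.cone A (A ⊗ B) :=
  T.comp_mem (T.rightUnitor_inv_mem _) (whiskerLeft_mem ht _)

theorem prepLeft_mem {A : C} {s : 𝟙_ C ⟶ A} (hs : s ∈ T.cone _ A) (B : C) :
    prepLeft s B ∈ T.cone B (A ⊗ B) :=
  T.comp_mem (T.leftUnitor_inv_mem _) (whiskerRight_mem hs _)

theorem testRight_mem (A : C) {B : C} {f : B ⟶ 𝟙_ C} (hf : f ∈ T.cone B _) :
    testRight A f ∈ T.cone (A ⊗ B) A :=
  T.comp_mem (whiskerLeft_mem hf _) (T.rightUnitor_hom_mem _)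

theorem testLeft_mem {A : C} {e : A ⟶ 𝟙_ C} (he : e ∈ T.cone A _) (B : C) :
    testLeft e B ∈ T.cone (A ⊗ B) B :=
  T.comp_mem (whiskerRight_mem he _) (T.leftUnitor_hom_mem _)

theorem tensorμ_mem (X₁ X₂ Y₁ Y₂ : C) :
    tensorμ X₁ X₂ Y₁ Y₂ ∈ T.cone ((X₁ ⊗ X₂) ⊗ (Y₁ ⊗ Y₂)) ((X₁ ⊗ Y₁) ⊗ (X₂ ⊗ Y₂)) :=
  T.comp_mem (T.associator_hom_mem _ _ _) <|
    T.comp_mem (whiskerLeft_mem (T.associator_inv_mem _ _ _) _) <|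
      T.comp_mem (whiskerLeft_mem (whiskerRight_mem (T.braiding_mem _ _) _) _) <|
        T.comp_mem (whiskerLeft_mem (T.associator_hom_mem _ _ _) _) (T.associator_inv_mem _ _ _)

theorem restrictLeft_mem {A B : C} {t : 𝟙_ C ⟶ B} (ht : t ∈ T.cone _ B) {f : B ⊗ B ⟶ 𝟙_ C}
    (hf : f ∈ T.cone (B ⊗ B) _) {χ : A ⊗ B ⟶ (A ⊗ B) ⊗ (A ⊗ B)} (hχ : χ ∈ T.cone _ _) :
    restrictLeft t f χ ∈ T.cone A (A ⊗ A) :=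
  T.comp_mem (prepRight_mem A ht) <| T.comp_mem hχ <|
    T.comp_mem (tensorμ_mem A B A B) (testRight_mem _ hf)

theorem restrictRight_mem {A B : C} {s : 𝟙_ C ⟶ A} (hs : s ∈ T.cone _ A) {e : A ⊗ A ⟶ 𝟙_ C}
    (he : e ∈ T.cone (A ⊗ A) _) {χ : A ⊗ B ⟶ (A ⊗ B) ⊗ (A ⊗ B)} (hχ : χ ∈ T.cone _ _) :
    restrictRight s e χ ∈ T.cone B (B ⊗ B) :=
  T.comp_mem (prepLeft_mem hs B) <| T.comp_mem hχ <|
    T.comp_mem (tensorμ_mem A B A B) (testLeft_mem he _)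

theorem num_nonneg {r : 𝟙_ C ⟶ 𝟙_ C} (hr : r ∈ T.cone _ _) : 0 ≤ T.num r :=
  (T.mem_cone_num r).1 hr

theorem eq_num_smul_id (r : 𝟙_ C ⟶ 𝟙_ C) : r = T.num r • 𝟙 (𝟙_ C) :=
  T.num.injective (by simp [T.num_id])

theorem ProcLE.comp_left {X A B : C} {f g : A ⟶ B} (h : T.ProcLE f g) {k : X ⟶ A}
    (hk : k ∈ T.cone X A) : T.ProcLE (k ≫ f) (k ≫ g) := by
  simpa only [ProcLE, Preadditive.comp_sub] using T.comp_mem hk h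

theorem ProcLE.num_comp_le {A : C} {e f : A ⟶ 𝟙_ C} (h : T.ProcLE e f) {s : 𝟙_ C ⟶ A}
    (hs : s ∈ T.cone _ A) : T.num (s ≫ e) ≤ T.num (s ≫ f) := by
  simpa only [map_sub, sub_nonneg] using num_nonneg (h.comp_left hs)

theorem disc_tensor_eq_tensorEffect (A B : C) :
    T.disc (A ⊗ B) = tensorEffect (T.disc A) (T.disc B) :=
  T.disc_tensor A B

theorem prepLeft_comp_disc {A : C} (s : 𝟙_ C ⟶ A) (B : C) :
    prepLeft s B ≫ T.disc (A ⊗ B) = T.num (s ≫ T.disc A) • T.disc B := by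
  rw [disc_tensor_eq_tensorEffect, prepLeft_comp_tensorEffect, eq_num_smul_id (T := T) (s ≫ _)]
  simp [T.num_id]

theorem restrictRight_comp_disc_procLE {A B : C} {s : 𝟙_ C ⟶ A} (hs : s ∈ T.cone _ A)
    {χ : A ⊗ B ⟶ (A ⊗ B) ⊗ (A ⊗ B)} (hχ : T.Subcausal χ) :
    T.ProcLE (restrictRight s (T.disc (A ⊗ A)) χ ≫ T.disc (B ⊗ B))
      (T.num (s ≫ T.disc A) • T.disc B) := by
  have hdisc : restrictRight s (T.disc (A ⊗ A)) χ ≫ T.disc (B ⊗ B) =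
      prepLeft s B ≫ χ ≫ T.disc ((A ⊗ B) ⊗ (A ⊗ B)) := by
    simp only [restrictRight, Category.assoc, testLeft_comp, disc_tensor_eq_tensorEffect,
      tensorμ_comp_tensorEffect]
  rw [hdisc, ← prepLeft_comp_disc]
  exact hχ.2.comp_left (prepLeft_mem hs B)

theorem Causal.num_comp_disc {A : C} {s : 𝟙_ C ⟶ A} (hs : T.Causal s) :
    T.num (s ≫ T.disc A) = 1 := by
  rw [hs.2, T.disc_unit, T.num_id]

end Processes

section Tomography

/-- The pairing of vectors of the state space with vectors of the effect space. -/
def pairing (T : GPT C) (A : C) : (𝟙_ C ⟶ A) →ₗ[ℝ] (A ⟶ 𝟙_ C) →ₗ[ℝ] ℝ :=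
  LinearMap.mk₂ ℝ (fun s e => T.num (s ≫ e)) (by simp) (by simp) (by simp) (by simp)

@[simp]
theorem pairing_apply {A : C} (s : 𝟙_ C ⟶ A) (e : A ⟶ 𝟙_ C) :
    T.pairing A s e = T.num (s ≫ e) := rfl

theorem isOrderUnit_disc (A : C) : IsOrderUnit (T.cone A (𝟙_ C)) (T.disc A) := by
  let _ : TopologicalSpace (A ⟶ 𝟙_ C) := moduleTopology ℝ _
  have : IsModuleTopology ℝ (A ⟶ 𝟙_ C) := ⟨rfl⟩
  have : ContinuousAdd (A ⟶ 𝟙_ C) := IsModuleTopology.toContinuousAdd ℝ _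
  exact isOrderUnit_of_mem_interior (T.disc_mem_interior A)

theorem effect_eq_of_forall_comp_eq {A : C} {e f : A ⟶ 𝟙_ C} (he : e ∈ T.cone A _)
    (hf : f ∈ T.cone A _) (h : ∀ s ∈ T.cone (𝟙_ C) A, s ≫ e = s ≫ f) : e = f := by
  refine T.tomography he hf fun D s k hs hk => ?_
  simp only [whiskerRight_comp_effect, ← Category.assoc]
  exact h _ (T.comp_mem hs (testRight_mem A (T.comp_mem (T.leftUnitor_inv_mem D) hk)))

theorem effect_eq_zero {A : C} {e : A ⟶ 𝟙_ C}
    (h : ∀ s ∈ T.cone (𝟙_ C) A, T.num (s ≫ e) = 0) : e = 0 := by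
  obtain ⟨c, hc, hce⟩ := isOrderUnit_disc (T := T) A e
  refine add_eq_left.1 (effect_eq_of_forall_comp_eq hce
    ((T.cone A _).smul_mem hc.le (T.disc_mem A)) fun s hs => T.num.injective ?_)
  simp [h s hs]

theorem pairing_surjective (A : C) : Function.Surjective (T.pairing A) := by
  have := T.finiteDimensional (𝟙_ C) A
  refine LinearMap.flip_injective_iff₁.1 ((injective_iff_map_eq_zero _).2 fun e he => ?_)
  exact effect_eq_zero fun s _ => LinearMap.congr_fun he s

theorem eq_zero_of_comp_disc {A B : C} {f : A ⟶ B} (hf : f ∈ T.cone A B)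
    (h : f ≫ T.disc B = 0) : f = 0 := by
  refine T.tomography hf (zero_mem _) fun D s e hs _ => T.num.injective ?_
  have hmem : s ≫ f ▷ D ∈ T.cone _ _ := T.comp_mem hs (whiskerRight_mem hf D)
  have hdisc : f ▷ D ≫ T.disc (B ⊗ D) = 0 := by
    rw [T.disc_tensor, MonoidalCategory.tensorHom_def, Category.assoc, ← comp_whiskerRight_assoc, h]
    simp
  have hzero : T.pairing (B ⊗ D) (s ≫ f ▷ D) = 0 :=
    (isOrderUnit_disc (B ⊗ D)).eq_zero_of_apply_eq_zero
      (fun e he => num_nonneg (T.comp_mem hmem he)) (by simp [hdisc])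
  simpa using LinearMap.congr_fun hzero e

theorem num_comp_disc_pos {A : C} {s : 𝟙_ C ⟶ A} (hs : s ∈ T.cone _ A) (h0 : s ≠ 0) :
    0 < T.num (s ≫ T.disc A) := by
  refine (num_nonneg (T.comp_mem hs (T.disc_mem A))).lt_of_ne fun h => h0 ?_
  exact eq_zero_of_comp_disc hs (T.num.injective (by simpa using h.symm))

theorem num_comp_comp_disc_pos {A B : C} {u : 𝟙_ C ⟶ A} (hu : IsOrderUnit (T.cone (𝟙_ C) A) u)
    {f : A ⟶ B} (hf : f ∈ T.cone A B) (h0 : f ≠ 0) : 0 < T.num (u ≫ f ≫ T.disc B) := by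
  have hmem := T.comp_mem hf (T.disc_mem B)
  refine (num_nonneg (T.comp_mem hu.mem hmem)).lt_of_ne fun h => h0 ?_
  have hzero : (T.pairing A).flip (f ≫ T.disc B) = 0 :=
    hu.eq_zero_of_apply_eq_zero (fun s hs => num_nonneg (T.comp_mem hs hmem)) h.symm
  exact eq_zero_of_comp_disc hf (effect_eq_zero fun s _ => LinearMap.congr_fun hzero s)

theorem span_causal (A : C) : Submodule.span ℝ {s : 𝟙_ C ⟶ A | T.Causal s} = ⊤ := by
  rw [eq_top_iff, ← T.span_cone, Submodule.span_le]
  intro s hs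
  rcases eq_or_ne s 0 with rfl | h0
  · exact zero_mem _
  have hpos := num_comp_disc_pos hs h0
  have hcausal : T.Causal ((T.num (s ≫ T.disc A))⁻¹ • s) :=
    ⟨(T.cone _ A).smul_mem (inv_nonneg.2 hpos.le) hs,
      T.num.injective (by simp [T.disc_unit, T.num_id, hpos.ne'])⟩
  rw [← smul_inv_smul₀ hpos.ne' s]
  exact Submodule.smul_mem _ _ (Submodule.subset_span hcausal)

theorem isCompact_setOf_subcausal (A B : C) :
    @IsCompact (A ⟶ B) (moduleTopology ℝ (A ⟶ B)) {f | T.Subcausal f} := by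
  have := T.finiteDimensional (𝟙_ C) A
  have := T.finiteDimensional A B
  let _ : TopologicalSpace (A ⟶ B) := moduleTopology ℝ _
  let _ : TopologicalSpace (A ⟶ 𝟙_ C) := moduleTopology ℝ _
  have : IsModuleTopology ℝ (A ⟶ B) := ⟨rfl⟩
  have : IsModuleTopology ℝ (A ⟶ 𝟙_ C) := ⟨rfl⟩
  have : IsTopologicalAddGroup (A ⟶ B) := IsModuleTopology.topologicalAddGroup ℝ _
  have : IsTopologicalAddGroup (A ⟶ 𝟙_ C) := IsModuleTopology.topologicalAddGroup ℝ _
  have : T2Space (A ⟶ B) := t2Space_of_isModuleTopology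
  obtain ⟨u, hu⟩ := exists_isOrderUnit_of_span_eq_top (T.span_cone (𝟙_ C) A)
  have hdisc : Continuous fun f : A ⟶ B => f ≫ T.disc B :=
    IsModuleTopology.continuous_of_linearMap (Linear.rightComp ℝ A (T.disc B))
  refine (isCompact_setOf_mem_cone_and_le (T.isClosed_cone A B)
    (l := T.pairing A u ∘ₗ Linear.rightComp ℝ A (T.disc B))
    (fun f hf h0 => num_comp_comp_disc_pos hu hf h0)
    (T.num (u ≫ T.disc A))).of_isClosed_subset ?_
    fun f hf => ⟨hf.1, hf.2.num_comp_le hu.mem⟩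
  exact (T.isClosed_cone A B).inter
    ((T.isClosed_cone A (𝟙_ C)).preimage (continuous_const.sub hdisc))

end Tomography

section Success

variable {A B : C} (S : BankStrategy T A)

/-- The success probability as a linear functional of the machine. -/
def successₗ : (A ⟶ A ⊗ A) →ₗ[ℝ] ℝ :=
  ∑ i, S.p i • (T.pairing A (S.s i) ∘ₗ Linear.rightComp ℝ A (tensorEffect (S.e i) (S.e i)))

@[simp]
theorem successₗ_apply (χ : A ⟶ A ⊗ A) : successₗ S χ = T.success S χ := by
  simp [successₗ, success]

/-- The average state of a bank strategy. -/
def BankStrategy.average : 𝟙_ C ⟶ A := ∑ i, S.p i • S.s i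

theorem average_mem : S.average ∈ T.cone _ A :=
  Submodule.sum_mem _ fun i _ => (T.cone _ A).smul_mem (S.p_pos i).le (S.s_causal i).1

theorem num_average_comp (e : A ⟶ 𝟙_ C) :
    T.num (S.average ≫ e) = ∑ i, S.p i * T.num (S.s i ≫ e) := by
  simp [BankStrategy.average, Preadditive.sum_comp]

theorem num_average_comp_disc : T.num (S.average ≫ T.disc A) = 1 := by
  simp [num_average_comp, (S.s_causal _).num_comp_disc, S.p_sum]

variable {S} in
theorem Spanning.isOrderUnit_average (hS : T.Spanning S) :
    IsOrderUnit (T.cone (𝟙_ C) A) S.average :=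
  isOrderUnit_sum_smul (fun i => (S.s_causal i).1) S.p_pos hS

/-- A physical state `τ` that is feasible for the dual of the program defining `alpha`: the success
probability of every process is bounded by its total output on `τ`. -/
def DualFeasible (τ : 𝟙_ C ⟶ A) : Prop :=
  τ ∈ T.cone (𝟙_ C) A ∧
    ∀ χ ∈ T.cone A (A ⊗ A), T.success S χ ≤ T.num (τ ≫ χ ≫ T.disc (A ⊗ A))

theorem dualFeasible_average : DualFeasible S S.average := by
  refine ⟨average_mem S, fun χ hχ => ?_⟩
  rw [num_average_comp, success]
  refine Finset.sum_le_sum fun i _ => mul_le_mul_of_nonneg_left ?_ (S.p_pos i).le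
  simp only [← Category.assoc]
  exact ((S.prod S).e_le (i, i)).num_comp_le (T.comp_mem (S.s_causal i).1 hχ)

theorem success_nonneg {χ : A ⟶ A ⊗ A} (hχ : χ ∈ T.cone _ _) : 0 ≤ T.success S χ :=
  Finset.sum_nonneg fun i _ => mul_nonneg (S.p_pos i).le <| num_nonneg <|
    T.comp_mem (S.s_causal i).1 <| T.comp_mem hχ <| tensorEffect_mem (S.e_mem i) (S.e_mem i)

theorem success_le_of_procLE_smul_disc {χ : A ⟶ A ⊗ A} (hχ : χ ∈ T.cone _ _) {c : ℝ}
    (h : T.ProcLE (χ ≫ T.disc (A ⊗ A)) (c • T.disc A)) : T.success S χ ≤ c :=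
  ((dualFeasible_average S).2 χ hχ).trans <|
    (h.num_comp_le (average_mem S)).trans_eq (by simp [num_average_comp_disc])

theorem success_le_one {χ : A ⟶ A ⊗ A} (hχ : T.Subcausal χ) : T.success S χ ≤ 1 :=
  success_le_of_procLE_smul_disc S hχ.1 (by simpa using hχ.2)

theorem success_le_alpha {χ : A ⟶ A ⊗ A} (hχ : T.Subcausal χ) : T.success S χ ≤ T.alpha S :=
  le_csSup ⟨1, Set.forall_mem_image.2 fun _ => success_le_one S⟩ ⟨χ, hχ, rfl⟩

theorem subcausal_zero : T.Subcausal (0 : A ⟶ B) :=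
  ⟨zero_mem _, by simpa [ProcLE] using T.disc_mem A⟩

theorem alpha_le {c : ℝ} (h : ∀ χ, T.Subcausal χ → T.success S χ ≤ c) : T.alpha S ≤ c :=
  csSup_le ⟨_, 0, subcausal_zero, rfl⟩ (Set.forall_mem_image.2 h)

theorem alpha_le_one : T.alpha S ≤ 1 :=
  alpha_le S fun _ => success_le_one S

theorem alpha_nonneg : 0 ≤ T.alpha S :=
  (success_nonneg S (zero_mem _)).trans (success_le_alpha S subcausal_zero)

theorem exists_success_eq_alpha : ∃ χ ∈ T.machines A, T.success S χ = T.alpha S := by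
  let _ : TopologicalSpace (A ⟶ A ⊗ A) := moduleTopology ℝ _
  have : IsModuleTopology ℝ (A ⟶ A ⊗ A) := ⟨rfl⟩
  have hcont : Continuous (successₗ S) := IsModuleTopology.continuous_of_linearMap _
  obtain ⟨χ, hχ, hmax⟩ :=
    (isCompact_setOf_subcausal A (A ⊗ A)).exists_isMaxOn ⟨0, subcausal_zero⟩ hcont.continuousOn
  refine ⟨χ, hχ, (success_le_alpha S hχ).antisymm (alpha_le S fun ψ hψ => ?_)⟩
  simpa using hmax hψ

theorem success_le_mul_alpha {χ : A ⟶ A ⊗ A} (hχ : χ ∈ T.cone _ _) {c : ℝ}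
    (h : T.ProcLE (χ ≫ T.disc (A ⊗ A)) (c • T.disc A)) : T.success S χ ≤ c * T.alpha S := by
  have hle : T.success S χ ≤ c := success_le_of_procLE_smul_disc S hχ h
  rcases ((success_nonneg S hχ).trans hle).eq_or_lt with rfl | hc
  · simpa using hle
  have hsub : T.Subcausal (c⁻¹ • χ) := by
    refine ⟨(T.cone _ _).smul_mem (inv_nonneg.2 hc.le) hχ, ?_⟩
    have := (T.cone _ _).smul_mem (inv_nonneg.2 hc.le) h
    rwa [smul_sub, inv_smul_smul₀ hc.ne', ← Linear.smul_comp] at this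
  have hscaled := success_le_alpha S hsub
  rwa [← successₗ_apply, map_smul, successₗ_apply, smul_eq_mul, inv_mul_le_iff₀ hc] at hscaled

end Success

section Duality

variable {A B : C} {S : BankStrategy T A}

theorem exists_dual_vector (S : BankStrategy T A) :
    ∃ v : 𝟙_ C ⟶ A, T.num (v ≫ T.disc A) = T.alpha S ∧
      ∀ χ ∈ T.cone A (A ⊗ A), T.success S χ ≤ T.num (v ≫ χ ≫ T.disc (A ⊗ A)) := by
  obtain ⟨φ, hφ_disc, -, hφ⟩ := exists_dual_functional (isOrderUnit_disc A)
    (Linear.rightComp ℝ A (T.disc (A ⊗ A))) (successₗ S) (β := T.alpha S)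
    (fun χ hχ t h => (successₗ_apply S χ).trans_le (success_le_mul_alpha S hχ h))
  obtain ⟨v, rfl⟩ := pairing_surjective (T := T) A φ
  exact ⟨v, hφ_disc, by simpa using hφ⟩

theorem Spanning.exists_dualFeasible (hS : T.Spanning S) (hα : T.alpha S < 1) :
    ∃ τ, DualFeasible S τ ∧ 0 < T.num (τ ≫ T.disc A) ∧ T.num (τ ≫ T.disc A) < 1 := by
  obtain ⟨v, hv_disc, hv⟩ := exists_dual_vector S
  obtain ⟨c, hc, hcv⟩ := hS.isOrderUnit_average v
  have hc1 : 0 < c + 1 := by linarith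
  have num_mix (e : A ⟶ 𝟙_ C) : T.num (((c + 1)⁻¹ • (c • S.average + v)) ≫ e) =
      (c * T.num (S.average ≫ e) + T.num (v ≫ e)) / (c + 1) := by
    simp [div_eq_inv_mul, mul_add]
  have num_disc : T.num (((c + 1)⁻¹ • (c • S.average + v)) ≫ T.disc A) =
      (c + T.alpha S) / (c + 1) := by
    rw [num_mix, num_average_comp_disc, hv_disc, mul_one]
  refine ⟨(c + 1)⁻¹ • (c • S.average + v),
    ⟨(T.cone _ A).smul_mem (inv_nonneg.2 hc1.le) hcv, fun χ hχ => ?_⟩, ?_, ?_⟩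
  · rw [num_mix, le_div_iff₀ hc1]
    have := mul_le_mul_of_nonneg_left ((dualFeasible_average S).2 χ hχ) hc.le
    linarith [hv χ hχ]
  · rw [num_disc]
    exact div_pos (add_pos_of_pos_of_nonneg hc (alpha_nonneg S)) hc1
  · rw [num_disc, div_lt_one hc1]
    linarith

theorem success_prod (S : BankStrategy T A) (S' : BankStrategy T B)
    (χ : A ⊗ B ⟶ (A ⊗ B) ⊗ (A ⊗ B)) :
    T.success (S.prod S') χ = ∑ j, S'.p j *
      T.success S (restrictLeft (S'.s j) (tensorEffect (S'.e j) (S'.e j)) χ) := by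
  simp only [success, comp_restrictLeft_comp, tensorμ_comp_tensorEffect, Finset.mul_sum]
  refine (Fintype.sum_prod_type_right _).trans ?_
  exact Finset.sum_congr rfl fun j _ => Finset.sum_congr rfl fun i _ =>
    (mul_assoc _ _ _).trans (mul_left_comm _ _ _)

theorem DualFeasible.success_prod_le {τ : 𝟙_ C ⟶ A} (hτ : DualFeasible S τ)
    (S' : BankStrategy T B) {χ : A ⊗ B ⟶ (A ⊗ B) ⊗ (A ⊗ B)} (hχ : χ ∈ T.cone _ _) :
    T.success (S.prod S') χ ≤ T.success S' (restrictRight τ (T.disc (A ⊗ A)) χ) := by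
  rw [success_prod]
  refine Finset.sum_le_sum fun j _ => mul_le_mul_of_nonneg_left ?_ (S'.p_pos j).le
  rw [comp_restrictRight_comp, ← comp_restrictLeft_comp]
  exact hτ.2 _ (restrictLeft_mem (S'.s_causal j).1
    (tensorEffect_mem (S'.e_mem j) (S'.e_mem j)) hχ)

theorem DualFeasible.alpha_prod_le {τ : 𝟙_ C ⟶ A} (hτ : DualFeasible S τ)
    (S' : BankStrategy T B) : T.alpha (S.prod S') ≤ T.num (τ ≫ T.disc A) * T.alpha S' :=
  alpha_le _ fun _ hχ => (hτ.success_prod_le S' hχ.1).trans <|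
    success_le_mul_alpha S' (restrictRight_mem hτ.1 (T.disc_mem _) hχ.1)
      (restrictRight_comp_disc_procLE hτ.1 hχ)

theorem Spanning.exponentiallySecure (hS : T.Spanning S) (hα : T.alpha S < 1) :
    T.ExponentiallySecure S := by
  obtain ⟨τ, hτ, hpos, hlt⟩ := hS.exists_dualFeasible hα
  refine ⟨_, hpos, hlt, fun n => ?_⟩
  induction n with
  | zero => simpa using alpha_le_one (S.rep 0)
  | succ n ih =>
    rw [pow_succ']
    exact (hτ.alpha_prod_le (S.rep n)).trans (mul_le_mul_of_nonneg_left ih hpos.le)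

end Duality

section Mixing

variable {A : C}

/-- The even mixture of two bank strategies on the same system. -/
noncomputable def BankStrategy.mix (S S' : BankStrategy T A) : BankStrategy T A where
  ι := S.ι ⊕ S'.ι
  fintype := inferInstance
  p := Sum.elim (fun i => S.p i / 2) (fun j => S'.p j / 2)
  p_pos := Sum.rec (fun i => half_pos (S.p_pos i)) (fun j => half_pos (S'.p_pos j))
  p_sum := by simp [← Finset.sum_div, S.p_sum, S'.p_sum, ← two_mul]
  s := Sum.elim S.s S'.s
  s_causal := Sum.rec S.s_causal S'.s_causal
  e := Sum.elim S.e S'.e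
  e_mem := Sum.rec S.e_mem S'.e_mem
  e_le := Sum.rec S.e_le S'.e_le
  accepts := Sum.rec S.accepts S'.accepts

theorem success_mix (S S' : BankStrategy T A) (χ : A ⟶ A ⊗ A) :
    T.success (S.mix S') χ = (T.success S χ + T.success S' χ) / 2 := by
  simp only [success, add_div, Finset.sum_div, ← div_mul_eq_mul_div]
  exact Fintype.sum_sum_type _

theorem alpha_mix_le (S S' : BankStrategy T A) :
    T.alpha (S.mix S') ≤ (T.alpha S + T.alpha S') / 2 := by
  refine alpha_le _ fun χ hχ => ?_
  rw [success_mix]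
  linarith [success_le_alpha S hχ, success_le_alpha S' hχ]

theorem Spanning.mix_right (S : BankStrategy T A) {S' : BankStrategy T A} (hS' : T.Spanning S') :
    T.Spanning (S.mix S') :=
  top_unique <| hS'.ge.trans <| Submodule.span_mono <|
    Set.range_subset_iff.2 fun j => ⟨Sum.inr j, rfl⟩

/-- The strategy that draws one of the causal states `t i` uniformly and accepts everything. -/
noncomputable def BankStrategy.uniform {ι : Type} [Fintype ι] [Nonempty ι] (t : ι → (𝟙_ C ⟶ A))
    (ht : ∀ i, T.Causal (t i)) : BankStrategy T A where
  ι := ι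
  fintype := inferInstance
  p _ := (Fintype.card ι : ℝ)⁻¹
  p_pos _ := inv_pos.2 (Nat.cast_pos.2 Fintype.card_pos)
  p_sum := by simp
  s := t
  s_causal := ht
  e _ := T.disc A
  e_mem _ := T.disc_mem A
  e_le _ := by simp [ProcLE]
  accepts i := (ht i).num_comp_disc

theorem Causal.ne_zero {s : 𝟙_ C ⟶ A} (hs : T.Causal s) : s ≠ 0 := by
  rintro rfl
  simpa using hs.num_comp_disc

theorem BankStrategy.nontrivial_states (S : BankStrategy T A) : Nontrivial (𝟙_ C ⟶ A) := by
  have : Nonempty S.ι := by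
    by_contra h
    rw [not_nonempty_iff] at h
    simpa using S.p_sum
  obtain ⟨i⟩ := this
  exact nontrivial_of_ne _ _ (S.s_causal i).ne_zero

theorem exists_spanning [Nontrivial (𝟙_ C ⟶ A)] : ∃ U : BankStrategy T A, T.Spanning U := by
  have := T.finiteDimensional (𝟙_ C) A
  obtain ⟨t, ht, hspan, -⟩ :=
    Submodule.exists_fun_fin_finrank_span_eq ℝ {s : 𝟙_ C ⟶ A | T.Causal s}
  replace hspan := hspan.trans (span_causal A)
  have range_nonempty : (Set.range t).Nonempty := by
    rw [Set.nonempty_iff_ne_empty]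
    intro h
    rw [h, Submodule.span_empty] at hspan
    exact bot_ne_top hspan
  have := Set.range_nonempty_iff_nonempty.1 range_nonempty
  exact ⟨.uniform t ht, hspan⟩

theorem exists_spanning_exponentiallySecure (S : BankStrategy T A) (hα : T.alpha S < 1) :
    ∃ S' : BankStrategy T A, T.Spanning S' ∧ T.alpha S' < 1 ∧ T.ExponentiallySecure S' := by
  have := S.nontrivial_states
  obtain ⟨U, hU⟩ := exists_spanning (T := T) (A := A)
  have hmix : T.alpha (S.mix U) < 1 := by linarith [alpha_mix_le S U, alpha_le_one U]
  exact ⟨S.mix U, hU.mix_right S, hmix, (hU.mix_right S).exponentiallySecure hmix⟩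

end Mixing

section Dichotomy

theorem ExponentiallySecure.exists_alpha_le {A : C} {S : BankStrategy T A}
    (hS : T.ExponentiallySecure S) {δ : ℝ} (hδ : 0 < δ) :
    ∃ n : ℕ, 1 ≤ n ∧ T.alpha (S.rep n) ≤ δ := by
  obtain ⟨r, hr0, hr1, hr⟩ := hS
  obtain ⟨n, hn⟩ := exists_pow_lt_of_lt_one hδ hr1
  refine ⟨n + 1, Nat.le_add_left 1 n, (hr _).trans (le_trans ?_ hn.le)⟩
  exact pow_le_pow_of_le_one hr0.le hr1.le n.le_succ

theorem ExponentiallySecure.wnc {A : C} {S : BankStrategy T A} (hS : T.ExponentiallySecure S) :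
    T.WNC := by
  obtain ⟨r, -, hr1, hr⟩ := hS
  exact ⟨_, S.rep 1, ((hr 1).trans_eq (pow_one r)).trans_lt hr1⟩

theorem wnc_iff_exists_spanning_exponentiallySecure :
    T.WNC ↔ ∃ (A : C) (S : BankStrategy T A), T.Spanning S ∧ T.ExponentiallySecure S := by
  constructor
  · rintro ⟨A, S, hα⟩
    obtain ⟨S', hspan, -, hS'⟩ := exists_spanning_exponentiallySecure S hα
    exact ⟨A, S', hspan, hS'⟩
  · rintro ⟨A, S, -, hS⟩
    exact hS.wnc

theorem wnc_iff_snc : T.WNC ↔ T.SNC := by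
  constructor
  · rw [wnc_iff_exists_spanning_exponentiallySecure]
    rintro ⟨A, S, -, hS⟩ δ hδ
    obtain ⟨n, -, hn⟩ := hS.exists_alpha_le hδ
    exact ⟨_, S.rep n, hn⟩
  · intro h
    obtain ⟨A, S, hS⟩ := h (1 / 2) one_half_pos
    exact ⟨A, S, hS.trans_lt one_half_lt_one⟩

theorem perfectCounterfeiting_iff_not_wnc : T.PerfectCounterfeiting ↔ ¬ T.WNC := by
  constructor
  · rintro h ⟨A, S, hα⟩
    exact hα.ne (h A S).1
  · intro h A S
    have hα : T.alpha S = 1 :=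
      (alpha_le_one S).antisymm (not_lt.1 fun hlt => h ⟨A, S, hlt⟩)
    obtain ⟨χ, hχ, hsuccess⟩ := exists_success_eq_alpha S
    exact ⟨hα, χ, hχ, hsuccess.trans hα⟩

end Dichotomy

end GPT

theorem mainTheorem1 {C : Type u} [Category.{v} C] [MonoidalCategory C] [SymmetricCategory C]
    [Preadditive C] [Linear ℝ C] [MonoidalPreadditive C] [MonoidalLinear ℝ C] (T : GPT C) :
    (T.WNC ↔ T.SNC) ∧
    (∀ (A : C) (S' : GPT.BankStrategy T A), T.alpha S' < 1 →
      ∃ S : GPT.BankStrategy T A, T.Spanning S ∧ T.alpha S < 1 ∧ T.ExponentiallySecure S ∧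
        ∀ δ : ℝ, 0 < δ → ∃ n : ℕ, 1 ≤ n ∧ T.alpha (S.rep n) ≤ δ) ∧
    Xor T.PerfectCounterfeiting
      (∃ (A : C) (S : GPT.BankStrategy T A), T.Spanning S ∧ T.ExponentiallySecure S) := by
  refine ⟨GPT.wnc_iff_snc, fun A S' hα => ?_, ?_⟩
  · obtain ⟨S, hspan, hα, hS⟩ := GPT.exists_spanning_exponentiallySecure S' hα
    exact ⟨S, hspan, hα, hS, fun δ hδ => hS.exists_alpha_le hδ⟩
  · rw [GPT.perfectCounterfeiting_iff_not_wnc, xor_not_left]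
    exact GPT.wnc_iff_exists_spanning_exponentiallySecure
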